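/- Let $Q$ be a finite-dimensional smooth manifold, $\pi_Q:T^*Q\to Q$ its cotangent bundle with canonical symplectic form $\omega_Q=dq^A\wedge dp_A$, and let $L:TQ\to\mathbb R$ be a smooth almost regular Lagrangian. That is, for the Legendre transformation $FL:TQ\to T^*Q$ (the fibre derivative of $L$), the image $M_1=FL(TQ)$ is an embedded submanifold of $T^*Q$ and $FL:TQ\to M_1$ is a submersion with connected fibres. Let $j_1:M_1\to T^*Q$ be the inclusion, $\omega_1=j_1^*\omega_Q$, and let $h_1:M_1\to\mathbb R$ be the projection of the energy, $h_1\circ FL=E_L$, where $E_L(v)=\langle FL(v),v\rangle-L(v)$. The Hinds algorithm is the following: $N_1=M_1$ and, for $l\ge 1$, $$N_{l+1}=\{p\in N_l:\ \text{there is } X\in T_pN_l \text{ with } i_X\omega_l=dh_l \text{ at } p\},$$ where $k_l:N_l\to M_1$ is the inclusion, $\omega_l=k_l^*\omega_1$ and $h_l=k_l^*h_1$. Assume that the sets $N_l$ are embedded submanifolds and that the algorithm stabilizes, $N_{k+1}=N_k=:N_f$ for some $k\geq 1$; write $\omega_f=\omega_k$ and $h_f=h_k$, and let $X$ be a smooth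 vector field on $N_f$ with $i_X\omega_f=dh_f$. Assume further that $Q_f=\pi_Q(N_f)$ is an embedded submanifold of $Q$ and that the restriction $\pi_f:N_f\to Q_f$ of $\pi_Q$ is a submersion. Let $\gamma$ be a smooth 1-form on $Q$ with $\gamma(Q_f)\subset N_f$ and such that $d\gamma(u,v)=0$ for all $q\in Q_f$ and $u,v\in T_qQ_f$ (for instance, $d\gamma=0$ at all points of $Q_f$). Let $\gamma_f:Q_f\to N_f$ be the restriction of $\gamma$ and $X^\gamma=T\pi_f\circ X\circ\gamma_f$, a vector field on $Q_f$. Then $$X-T\gamma_f(X^\gamma)\in\ker\omega_f\ \text{ along } \gamma_f(Q_f)\quad\Longleftrightarrow\quad d(h_1\circ\gamma_f)=0 \text{ on } Q_f,$$ where the left-hand side means $X(\gamma_f(q))-T_q\gamma_f(X^\gamma(q))\in\ker\omega_f(\gamma_f(q))$ for every $q\in Q_f$. -/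

import Mathlib

open Set Manifold
open scoped ContDiff

noncomputable section

/-! ### Differential forms on manifolds -/

section Forms

variable {E H M : Type*} [NormedAddCommGroup E] [NormedSpace ℝ E] [TopologicalSpace H]
  [TopologicalSpace M] [ChartedSpace H M]
  {E' H' M' : Type*} [NormedAddCommGroup E'] [NormedSpace ℝ E'] [TopologicalSpace H']
  [TopologicalSpace M'] [ChartedSpace H' M']

/-- A (not necessarily smooth) differential 1-form on a manifold. -/
abbrev OneForm (I : ModelWithCorners ℝ E H) (M : Type*) [TopologicalSpace M] [ChartedSpace H M] :=
  ∀ x : M, TangentSpace I x →L[ℝ] ℝ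

/-- A (not necessarily smooth) differential 2-form on a manifold. -/
abbrev TwoForm (I : ModelWithCorners ℝ E H) (M : Type*) [TopologicalSpace M] [ChartedSpace H M] :=
  ∀ x : M, TangentSpace I x [⋀^Fin 2]→L[ℝ] ℝ

/-- The expression of a 1-form in the chart around `x`, that is, its pullback to the model vector
space under the inverse of the chart. -/
def OneForm.inChart {I : ModelWithCorners ℝ E H} (α : OneForm I M) (x : M) :
    E → E [⋀^Fin 1]→L[ℝ] ℝ := fun y =>
  ContinuousAlternatingMap.ofSubsingleton ℝ E ℝ (0 : Fin 1)
    ((α ((extChartAt I x).symm y)).comp (mfderiv 𝓘(ℝ, E) I (extChartAt I x).symm y))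

/-- The exterior derivative of a 1-form on a manifold without boundary: at `x`, it is the exterior
derivative of the expression of the form in the chart around `x`, pulled back by the chart. The
convention is `dα(u, v) = u(α(v)) - v(α(u)) - α([u, v])`. -/
def OneForm.d {I : ModelWithCorners ℝ E H} [I.Boundaryless] (α : OneForm I M) : TwoForm I M :=
  fun x => (extDeriv (α.inChart x) (extChartAt I x x)).compContinuousLinearMap
    (mfderiv I 𝓘(ℝ, E) (extChartAt I x) x)

/-- The pullback of a 2-form by a map. -/
def TwoForm.pullback {I : ModelWithCorners ℝ E H} {I' : ModelWithCorners ℝ E' H'}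
    (f : M → M') (β : TwoForm I' M') : TwoForm I M :=
  fun x => (β (f x)).compContinuousLinearMap (mfderiv I I' f x)

/-- The kernel at `x` of a 2-form: the tangent vectors `u` with `i_u β = 0`. -/
def TwoForm.ker {I : ModelWithCorners ℝ E H} (β : TwoForm I M) (x : M) : Set (TangentSpace I x) :=
  {u | ∀ v : TangentSpace I x, β x ![u, v] = 0}

/-- `u ∈ T_xM` satisfies the equation `i_u β = dh` at the point `x`. -/
def SolvesAt {I : ModelWithCorners ℝ E H} (β : TwoForm I M) (h : M → ℝ) (x : M)
    (u : TangentSpace I x) : Prop :=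
  ∀ v : TangentSpace I x, β x ![u, v] = mfderiv I 𝓘(ℝ, ℝ) h x v

/-- An (embedded, smooth) submanifold of `M`: a subset with a smooth structure, inducing the
subspace topology, for which the inclusion is a smooth embedding. -/
structure EmbeddedSubmanifold (I : ModelWithCorners ℝ E H) (M : Type*) [TopologicalSpace M]
    [ChartedSpace H M] where
  carrier : Set M
  dim : ℕ
  chartedSpace : ChartedSpace (EuclideanSpace ℝ (Fin dim)) carrier
  isManifold : IsManifold (𝓡 dim) ∞ carrier
  isSmoothEmbedding : IsSmoothEmbedding (𝓡 dim) I ∞ (Subtype.val : carrier → M)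

instance {I : ModelWithCorners ℝ E H} (S : EmbeddedSubmanifold I M) :
    ChartedSpace (EuclideanSpace ℝ (Fin S.dim)) S.carrier := S.chartedSpace

instance {I : ModelWithCorners ℝ E H} (S : EmbeddedSubmanifold I M) :
    IsManifold (𝓡 S.dim) ∞ S.carrier := S.isManifold

end Forms

/-! ### The cotangent bundle, the Legendre transformation and almost regular Lagrangians -/

section Mechanics

variable {E : Type*} [NormedAddCommGroup E] [NormedSpace ℝ E]
  {Q : Type*} [TopologicalSpace Q] [ChartedSpace E Q] [IsManifold 𝓘(ℝ, E) ∞ Q]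

variable (E Q) in
/-- The cotangent bundle `T*Q` of a manifold `Q` modelled on `E`; its elements are pairs
`⟨q, p⟩` with `q : Q` and `p : T_qQ →L[ℝ] ℝ`. -/
abbrev Cotangent := Bundle.TotalSpace (E →L[ℝ] ℝ)
  (fun q : Q => TangentSpace 𝓘(ℝ, E) q →L[ℝ] ℝ)

variable (E) in
/-- The model with corners of `T*Q`. -/
abbrev cotModel := (𝓘(ℝ, E)).prod 𝓘(ℝ, E →L[ℝ] ℝ)

variable (E Q) in
/-- The tautological (Liouville) 1-form `θ = p_A dq^A` of `T*Q`. -/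
def liouvilleForm : OneForm (cotModel E) (Cotangent E Q) := fun p =>
  p.2.comp (mfderiv (cotModel E) 𝓘(ℝ, E) (Bundle.TotalSpace.proj : Cotangent E Q → Q) p)

variable (E Q) in
/-- The canonical symplectic form `ω_Q = -dθ = dq^A ∧ dp_A` of `T*Q`. -/
def canonicalForm : TwoForm (cotModel E) (Cotangent E Q) := fun p => -((liouvilleForm E Q).d p)

/-- The Legendre transformation `FL : TQ → T*Q`, i.e. the fibre derivative of `L`. -/
def legendre (L : TangentBundle 𝓘(ℝ, E) Q → ℝ) (v : TangentBundle 𝓘(ℝ, E) Q) : Cotangent E Q :=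
  ⟨v.proj, fderiv ℝ (fun w : TangentSpace 𝓘(ℝ, E) v.proj => L ⟨v.proj, w⟩) v.2⟩

/-- The energy `E_L = Δ(L) - L`, where `Δ` is the Liouville vector field of `TQ`. -/
def energy (L : TangentBundle 𝓘(ℝ, E) Q → ℝ) (v : TangentBundle 𝓘(ℝ, E) Q) : ℝ :=
  (legendre L v).2 v.2 - L v

/-- The Legendre transformation with its values in `M₁ = FL(TQ)`. -/
def legendreTo (L : TangentBundle 𝓘(ℝ, E) Q → ℝ) {M₁ : Set (Cotangent E Q)}
    (h : M₁ = range (legendre L)) : TangentBundle 𝓘(ℝ, E) Q → M₁ :=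
  fun v => ⟨legendre L v, h ▸ mem_range_self v⟩

/-- `L` is almost regular with primary constraint submanifold `M₁`: the image `M₁ = FL(TQ)` is a
submanifold of `T*Q`, and `FL : TQ → M₁` is a submersion with connected fibres. -/
structure IsAlmostRegular (L : TangentBundle 𝓘(ℝ, E) Q → ℝ)
    (M₁ : EmbeddedSubmanifold (cotModel E) (Cotangent E Q)) : Prop where
  carrier_eq : M₁.carrier = range (legendre L)
  isSubmersion : IsSubmersion (𝓘(ℝ, E)).tangent (𝓡 M₁.dim) ∞ (legendreTo L carrier_eq)
  isConnected_fibre : ∀ p : M₁.carrier, IsConnected (legendreTo L carrier_eq ⁻¹' {p})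

variable (M₁ : EmbeddedSubmanifold (cotModel E) (Cotangent E Q))

/-- The form `ω₁ = j₁^* ω_Q` on `M₁`. -/
def primaryForm : TwoForm (𝓡 M₁.dim) M₁.carrier :=
  TwoForm.pullback Subtype.val (canonicalForm E Q)

variable {M₁}

/-- The form `ω_N = k^* ω₁` on a submanifold `k : N → M₁`. -/
def constraintForm (N : EmbeddedSubmanifold (𝓡 M₁.dim) M₁.carrier) :
    TwoForm (𝓡 N.dim) N.carrier :=
  TwoForm.pullback Subtype.val (primaryForm M₁)

/-- The function `h_N = k^* h₁` on a submanifold `k : N → M₁`. -/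
def constraintFun (h₁ : M₁.carrier → ℝ) (N : EmbeddedSubmanifold (𝓡 M₁.dim) M₁.carrier) :
    N.carrier → ℝ :=
  fun p => h₁ p

/-- One step of the Hinds algorithm: the points `p` of `N` for which there is `X ∈ T_pN` with
`i_X ω_N = dh_N`. -/
def hindsStep (h₁ : M₁.carrier → ℝ) (N : EmbeddedSubmanifold (𝓡 M₁.dim) M₁.carrier) :
    Set M₁.carrier :=
  {p | ∃ (hp : p ∈ N.carrier) (X : TangentSpace (𝓡 N.dim) (⟨p, hp⟩ : N.carrier)),
    SolvesAt (constraintForm N) (constraintFun h₁ N) ⟨p, hp⟩ X}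

/-- `N 1, …, N k` are the constraint submanifolds produced by the Hinds algorithm started from
`N 1 = M₁`, and the algorithm stabilizes at step `k`. (The entries of the sequence `N` with an
index outside of `1, …, k` play no role.) -/
structure HindsStabilizes (h₁ : M₁.carrier → ℝ)
    (N : ℕ → EmbeddedSubmanifold (𝓡 M₁.dim) M₁.carrier) (k : ℕ) : Prop where
  one_le : 1 ≤ k
  first : (N 1).carrier = univ
  step : ∀ l, 1 ≤ l → l < k → (N (l + 1)).carrier = hindsStep h₁ (N l)
  stable : hindsStep h₁ (N k) = (N k).carrier

variable {N : EmbeddedSubmanifold (𝓡 M₁.dim) M₁.carrier} {P : EmbeddedSubmanifold 𝓘(ℝ, E) Q}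

/-- The base point in `Q` of a point of `N ⊆ M₁ ⊆ T*Q`. -/
def basePoint (p : N.carrier) : Q := p.1.1.proj

/-- The restriction `π_N : N → P` of the projection of `T*Q`, where `P = π_Q(N)`. -/
def projTo (hP : P.carrier = range (basePoint (N := N))) : N.carrier → P.carrier :=
  fun p => ⟨basePoint p, hP ▸ mem_range_self p⟩

/-- The restriction to `P ⊆ Q` of a 1-form `γ` on `Q`, regarded as a map into `N`, when
`γ(P) ⊆ N`. -/
def restrictTo (γ : OneForm 𝓘(ℝ, E) Q)
    (hγ : ∀ q ∈ P.carrier, ∃ hq : (⟨q, γ q⟩ : Cotangent E Q) ∈ M₁.carrier,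
      (⟨⟨q, γ q⟩, hq⟩ : M₁.carrier) ∈ N.carrier) : P.carrier → N.carrier :=
  fun q => ⟨⟨⟨q, γ q⟩, (hγ q q.2).1⟩, (hγ q q.2).2⟩

/-- The vector field `X^γ = Tπ_N ∘ X ∘ γ_P` on `P = π_Q(N)`. -/
def projectedField (hP : P.carrier = range (basePoint (N := N))) (γ : OneForm 𝓘(ℝ, E) Q)
    (hγ : ∀ q ∈ P.carrier, ∃ hq : (⟨q, γ q⟩ : Cotangent E Q) ∈ M₁.carrier,
      (⟨⟨q, γ q⟩, hq⟩ : M₁.carrier) ∈ N.carrier)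
    (X : ∀ p : N.carrier, TangentSpace (𝓡 N.dim) p) (q : P.carrier) :
    TangentSpace (𝓡 P.dim) q :=
  mfderiv (𝓡 N.dim) (𝓡 P.dim) (projTo hP) (restrictTo γ hγ q) (X (restrictTo γ hγ q))

end Mechanics

end

/-! The statement is pointwise linear algebra on $T_pN_f$ at $p=\gamma_f(q)$. Since $\gamma_f$ is a
section of $\pi_f$, each tangent vector is the sum of a vertical vector, in $\ker T\pi_f$, and a
vector in the image of $T\gamma_f$. Both summands are isotropic for $\omega_f$: vertical vectors of
$N_f$ are vertical in $T^*Q$, whose fibres are Lagrangian (`constraintForm_vertical`), and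
$\gamma^*\omega_Q=-d\gamma$ vanishes on $TQ_f$ (`constraintForm_mfderiv_restrictTo`).

The vector $Y=X-T\gamma_f(X^\gamma)$ is vertical, so $\omega_f(Y,\cdot)$ kills vertical vectors,
while on $T\gamma_f(w)$ it equals
$\omega_f(X,T\gamma_f(w))=dh_f(T\gamma_f(w))=d(h_1\circ\gamma_f)(w)$. Hence $Y\in\ker\omega_f$
exactly when this differential vanishes (`forall_sub_apply_eq_zero_iff`).

Two ingredients need analysis: the coordinate formulas for $\omega_Q$ and $\gamma^*\omega_Q$
(`canonicalForm_apply`, `canonicalForm_mfderiv_oneForm`), and the differentiability of $h_1$, which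
descends from that of $E_L$ along the submersion $FL$. -/

open Filter Topology Bundle

/-! ### Smoothness descends along surjective submersions -/

section Submersion

variable {E H M : Type*} [NormedAddCommGroup E] [NormedSpace ℝ E] [TopologicalSpace H]
  [TopologicalSpace M] [ChartedSpace H M]
  {E' H' M' : Type*} [NormedAddCommGroup E'] [NormedSpace ℝ E'] [TopologicalSpace H']
  [TopologicalSpace M'] [ChartedSpace H' M']
  {E'' H'' M'' : Type*} [NormedAddCommGroup E''] [NormedSpace ℝ E''] [TopologicalSpace H'']
  [TopologicalSpace M''] [ChartedSpace H'' M'']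
  {I : ModelWithCorners ℝ E H} {I' : ModelWithCorners ℝ E' H'} {I'' : ModelWithCorners ℝ E'' H''}

/-- A submersion of manifolds without boundary has local sections through every point. -/
theorem Manifold.IsSubmersionAt.exists_local_section [I.Boundaryless] [I'.Boundaryless]
    {n : ℕ∞ω} {f : M → M'} {x : M} (hf : IsSubmersionAt I I' n f x) :
    ∃ s : M' → M, ContMDiffAt I' I n s (f x) ∧ s (f x) = x ∧ ∀ᶠ y in 𝓝 (f x), f (s y) = y := by
  set φ := hf.domChart
  set ψ := hf.codChart
  set e := hf.equiv
  have hxφ : x ∈ φ.source := hf.mem_domChart_source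
  have hxψ : f x ∈ ψ.source := hf.mem_codChart_source
  have htar : φ.extend I x ∈ (φ.extend I).target :=
    (φ.extend I).map_source (by rwa [φ.extend_source])
  have hopen : IsOpen (φ.extend I).target := φ.isOpen_extend_target
  have hfx : ψ.extend I' (f x) = (e (φ.extend I x)).1 := by
    have := hf.writtenInCharts htar
    simp only [Function.comp_apply] at this
    rwa [(φ.extend I).left_inv (by rwa [φ.extend_source])] at this
  -- In the charts `f` is a projection to the first factor; the section keeps the second coordinate
  -- frozen at its value for `x`.
  set t : M' → E := fun y => e.symm (ψ.extend I' y, (e (φ.extend I x)).2) with ht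
  have htx : t (f x) = φ.extend I x := by
    simp only [ht, hfx]
    exact e.symm_apply_apply _
  have htsmooth : ContMDiffAt I' 𝓘(ℝ, E) n t (f x) := by
    have h1 : ContMDiffAt I' 𝓘(ℝ, E') n (ψ.extend I') (f x) :=
      ψ.contMDiffAt_extend hf.codChart_mem_maximalAtlas hxψ
    exact (e.symm.contDiff.contMDiff.contMDiffAt).comp (f x)
      (h1.prodMk_space contMDiffAt_const)
  refine ⟨fun y => (φ.extend I).symm (t y), ?_, ?_, ?_⟩
  · have h2 : ContMDiffAt 𝓘(ℝ, E) I n (φ.extend I).symm (t (f x)) := by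
      rw [htx]
      have := contMDiffOn_extend_symm (I := I) hf.domChart_mem_maximalAtlas
      refine this.contMDiffAt ?_
      rw [← φ.extend_target']
      exact hopen.mem_nhds htar
    exact h2.comp (f x) htsmooth
  · simp only [htx]
    exact (φ.extend I).left_inv (by rwa [φ.extend_source])
  · have h3 : ∀ᶠ y in 𝓝 (f x), t y ∈ (φ.extend I).target :=
      htsmooth.continuousAt.eventually_mem (by rw [htx]; exact hopen.mem_nhds htar)
    filter_upwards [h3, ψ.open_source.mem_nhds hxψ] with y hy hyψ
    have h4 := hf.writtenInCharts hy
    simp only [Function.comp_apply] at h4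
    have h5 : (e (t y)).1 = ψ.extend I' y := by simp [ht]
    have h6 : f ((φ.extend I).symm (t y)) ∈ ψ.source := by
      apply hf.source_subset_preimage_source
      have := (φ.extend I).map_target hy
      rwa [φ.extend_source] at this
    -- Both `f (s y)` and `y` lie in the chart domain, so comparing their coordinates suffices.
    refine (ψ.extend I').injOn (by rwa [ψ.extend_source]) (by rwa [ψ.extend_source]) ?_
    exact h4.trans h5

/-- A function on the target of a surjective submersion is smooth as soon as its composition with
the submersion is. -/
theorem Manifold.IsSubmersion.contMDiff_of_comp [I.Boundaryless] [I'.Boundaryless]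
    {n : ℕ∞ω} {f : M → M'} (hf : IsSubmersion I I' n f) (hsurj : Function.Surjective f)
    {g : M' → M''} (hg : ContMDiff I I'' n (g ∘ f)) : ContMDiff I' I'' n g := by
  intro y
  obtain ⟨x, rfl⟩ := hsurj y
  obtain ⟨s, hs, hsx, hfs⟩ := (hf.isSubmersionAt x).exists_local_section
  have : ContMDiffAt I' I'' n ((g ∘ f) ∘ s) (f x) := (hg _).comp (f x) hs
  refine this.congr_of_eventuallyEq ?_
  filter_upwards [hfs] with y hy
  simp [hy]

end Submersion

theorem legendreTo_surjective {E : Type*} [NormedAddCommGroup E] [NormedSpace ℝ E]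
    {Q : Type*} [TopologicalSpace Q] [ChartedSpace E Q] {L : TangentBundle 𝓘(ℝ, E) Q → ℝ}
    {M₁ : Set (Cotangent E Q)} (h : M₁ = range (legendre L)) :
    Function.Surjective (legendreTo L h) := by
  rintro ⟨p, hp⟩
  obtain ⟨v, hv⟩ := h ▸ hp
  exact ⟨v, Subtype.ext hv⟩

/-! ### Smoothness of the energy and of its projection -/

section Energy

variable {E : Type*} [NormedAddCommGroup E] [NormedSpace ℝ E]
  {Q : Type*} [TopologicalSpace Q] [ChartedSpace E Q] [IsManifold 𝓘(ℝ, E) ∞ Q]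

instance : ContMDiffVectorBundle ∞ E (TangentSpace 𝓘(ℝ, E) : Q → Type _) 𝓘(ℝ, E) :=
  -- The tangent bundle costs one derivative, which is harmless because `∞ + 1` is `∞`.
  haveI : IsManifold 𝓘(ℝ, E) (∞ + 1) Q := ‹IsManifold 𝓘(ℝ, E) ∞ Q›
  TangentBundle.contMDiffVectorBundle

/-- The energy is smooth as soon as the Lagrangian and its Legendre transformation are. -/
theorem contMDiff_energy {L : TangentBundle 𝓘(ℝ, E) Q → ℝ}
    (hL : ContMDiff (𝓘(ℝ, E)).tangent 𝓘(ℝ, ℝ) ∞ L)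
    (hFL : ContMDiff (𝓘(ℝ, E)).tangent (cotModel E) ∞ (legendre L)) :
    ContMDiff (𝓘(ℝ, E)).tangent 𝓘(ℝ, ℝ) ∞ (energy L) := by
  -- The pairing of $FL(v)$ with $v$ is evaluation in a Hom bundle with values in the trivial line
  -- bundle; `h2` reads off its fibre component.
  have h1 := ContMDiff.clm_bundle_apply (n := ∞) (IB := 𝓘(ℝ, E)) (F₁ := E) (F₂ := ℝ)
    (E₁ := (TangentSpace 𝓘(ℝ, E) : Q → Type _)) (E₂ := fun _ : Q => ℝ)
    (b := fun v : TangentBundle 𝓘(ℝ, E) Q => v.proj) (v := fun v => v.2)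
    (ϕ := fun v => (legendre L v).2) hFL contMDiff_id
  have h2 : ContMDiff (𝓘(ℝ, E)).tangent 𝓘(ℝ, ℝ) ∞
      (fun v : TangentBundle 𝓘(ℝ, E) Q => (legendre L v).2 v.2) :=
    fun v => (contMDiffAt_totalSpace.1 (h1 v)).2
  exact h2.sub hL

/-- The projection of the energy to the primary constraint submanifold is smooth. -/
theorem IsAlmostRegular.contMDiff_of_comp_eq_energy {L : TangentBundle 𝓘(ℝ, E) Q → ℝ}
    {M₁ : EmbeddedSubmanifold (cotModel E) (Cotangent E Q)} (hM₁ : IsAlmostRegular L M₁)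
    (hL : ContMDiff (𝓘(ℝ, E)).tangent 𝓘(ℝ, ℝ) ∞ L) {h₁ : M₁.carrier → ℝ}
    (hh₁ : ∀ v, h₁ (legendreTo L hM₁.carrier_eq v) = energy L v) :
    ContMDiff (𝓡 M₁.dim) 𝓘(ℝ, ℝ) ∞ h₁ := by
  refine hM₁.isSubmersion.contMDiff_of_comp (legendreTo_surjective _) ?_
  have hFL : ContMDiff (𝓘(ℝ, E)).tangent (cotModel E) ∞ (legendre L) :=
    M₁.isSmoothEmbedding.contMDiff.comp hM₁.isSubmersion.contMDiff
  exact (contMDiff_energy hL hFL).congr hh₁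

end Energy

/-! ### The canonical symplectic form in coordinates -/

/-- The exterior derivative of a 1-form on a vector space, given as a field of functionals. -/
theorem extDeriv_ofSubsingleton_apply {E : Type*} [NormedAddCommGroup E] [NormedSpace ℝ E]
    {g : E → E →L[ℝ] ℝ} {x : E} (hg : DifferentiableAt ℝ g x) (u v : E) :
    extDeriv (fun y => ContinuousAlternatingMap.ofSubsingleton ℝ E ℝ (0 : Fin 1) (g y)) x ![u, v] =
      fderiv ℝ g x u v - fderiv ℝ g x v u := by
  have hd : DifferentiableAt ℝ
      (fun y => ContinuousAlternatingMap.ofSubsingleton ℝ E ℝ (0 : Fin 1) (g y)) x :=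
    (ContinuousAlternatingMap.ofSubsingletonLIE (𝕜 := ℝ) (E := E) (F := ℝ)
      (0 : Fin 1)).differentiable.differentiableAt.comp x hg
  rw [extDeriv_apply hd]
  have h (w : E) : fderiv ℝ (fun y => g y w) x = (fderiv ℝ g x).flip w := by
    ext z
    rw [fderiv_clm_apply hg (differentiableAt_const w)]
    simp
  simp [Fin.sum_univ_two, Fin.removeNth, h, sub_eq_add_neg]

/-- The exterior derivative of a 1-form with linear coefficients. -/
theorem extDeriv_ofSubsingleton_linear_apply {E : Type*} [NormedAddCommGroup E] [NormedSpace ℝ E]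
    (c : E →L[ℝ] E →L[ℝ] ℝ) (x u v : E) :
    extDeriv (fun y => ContinuousAlternatingMap.ofSubsingleton ℝ E ℝ (0 : Fin 1) (c y)) x ![u, v] =
      c u v - c v u := by
  rw [extDeriv_ofSubsingleton_apply c.differentiableAt, c.fderiv]

section Coordinates

variable {E : Type*} [NormedAddCommGroup E] [NormedSpace ℝ E]
  {Q : Type*} [TopologicalSpace Q] [ChartedSpace E Q] [IsManifold 𝓘(ℝ, E) ∞ Q]

/-- The expression of a covector in the chart of `T*Q` around `p`. -/
theorem Cotangent.extChartAt_apply (p x : Cotangent E Q)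
    (hx : x.proj ∈ (chartAt E p.proj).source) :
    extChartAt (cotModel E) p x = (extChartAt 𝓘(ℝ, E) p.proj x.proj,
      x.2.comp (mfderiv 𝓘(ℝ, E) 𝓘(ℝ, E) (extChartAt 𝓘(ℝ, E) p.proj).symm
        (extChartAt 𝓘(ℝ, E) p.proj x.proj))) := by
  have : IsManifold 𝓘(ℝ, E) 1 Q := IsManifold.of_le (n := ∞) (by simp)
  -- The inverse trivialization of $TQ$ is the derivative of the inverse chart, so the fibre
  -- coordinate of a covector is its pullback by that chart.
  have h := TangentBundle.symmL_trivializationAt (I := 𝓘(ℝ, E)) (x₀ := p.proj) (x := x.proj) hx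
  simp only [modelWithCornersSelf_coe, range_id, mfderivWithin_univ] at h
  rw [FiberBundle.extChartAt, ← h]
  simp [hom_trivializationAt_apply, ContinuousLinearMap.inCoordinates]
  rfl

/-- Characterizes the inverse chart through the forward formula, so that no explicit inverse has to
be computed. -/
theorem Cotangent.extChartAt_symm_spec (p : Cotangent E Q) {y : E × (E →L[ℝ] ℝ)}
    (hy : y ∈ (extChartAt (cotModel E) p).target) :
    ((extChartAt (cotModel E) p).symm y).proj ∈ (chartAt E p.proj).source ∧
    extChartAt 𝓘(ℝ, E) p.proj ((extChartAt (cotModel E) p).symm y).proj = y.1 ∧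
    (((extChartAt (cotModel E) p).symm y).2.comp (mfderiv 𝓘(ℝ, E) 𝓘(ℝ, E)
      (extChartAt 𝓘(ℝ, E) p.proj).symm y.1) : E →L[ℝ] ℝ) = y.2 := by
  have hsource : ((extChartAt (cotModel E) p).symm y).proj ∈ (chartAt E p.proj).source := by
    have h := (extChartAt (cotModel E) p).map_target hy
    rw [extChartAt_source, FiberBundle.chartedSpace_chartAt] at h
    have h2 := (Trivialization.mem_source _).1 h.1
    simpa using h2
  have h := Cotangent.extChartAt_apply p _ hsource
  rw [(extChartAt (cotModel E) p).right_inv hy] at h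
  have h1 := congrArg Prod.fst h
  have h2 := congrArg Prod.snd h
  simp only at h1 h2
  refine ⟨hsource, h1.symm, ?_⟩
  rw [← h1] at h2
  exact h2.symm

/-- The derivative of the projection of `T*Q`, in the chart at `p`. -/
theorem Cotangent.mfderiv_proj_apply (p : Cotangent E Q) (u : TangentSpace (cotModel E) p) :
    mfderiv (cotModel E) 𝓘(ℝ, E) (Bundle.TotalSpace.proj : Cotangent E Q → Q) p u =
      (show E × (E →L[ℝ] ℝ) from u).1 := by
  have hd : MDifferentiableAt (cotModel E) 𝓘(ℝ, E)
      (Bundle.TotalSpace.proj : Cotangent E Q → Q) p :=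
    (contMDiffAt_proj (n := 1) _).mdifferentiableAt one_ne_zero
  have h : writtenInExtChartAt (cotModel E) 𝓘(ℝ, E) p
      (Bundle.TotalSpace.proj : Cotangent E Q → Q) =ᶠ[𝓝 (extChartAt (cotModel E) p p)]
      Prod.fst := by
    filter_upwards [extChartAt_target_mem_nhds (I := cotModel E) p] with y hy
    exact (Cotangent.extChartAt_symm_spec p hy).2.1
  rw [hd.mfderiv, (cotModel E).range_eq_univ, fderivWithin_univ, h.fderiv_eq, fderiv_fst]
  rfl

/-- This is $\theta=p_A\,dq^A$: in bundle coordinates $\pi_Q$ is the first projection, and the fibre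
coordinate already contains the derivative of the inverse chart of $Q$. -/
theorem liouvilleForm_inChart_eventuallyEq (p : Cotangent E Q) :
    (liouvilleForm E Q).inChart p =ᶠ[𝓝 (extChartAt (cotModel E) p p)] fun y =>
      ContinuousAlternatingMap.ofSubsingleton ℝ (E × (E →L[ℝ] ℝ)) ℝ (0 : Fin 1)
        (y.2.comp (ContinuousLinearMap.fst ℝ E (E →L[ℝ] ℝ))) := by
  have hQ : IsManifold 𝓘(ℝ, E) 1 Q := IsManifold.of_le (n := ∞) (by simp)
  have hT : IsManifold (cotModel E) ∞ (Cotangent E Q) := inferInstance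
  have hT1 : IsManifold (cotModel E) 1 (Cotangent E Q) := IsManifold.of_le (n := ∞) (by simp)
  filter_upwards [extChartAt_target_mem_nhds (I := cotModel E) p] with y hy
  obtain ⟨hs, h1, h2⟩ := Cotangent.extChartAt_symm_spec p hy
  have hsymm : MDifferentiableAt 𝓘(ℝ, E × (E →L[ℝ] ℝ)) (cotModel E)
      (extChartAt (cotModel E) p).symm y := by
    have := mdifferentiableWithinAt_extChartAt_symm (I := cotModel E) hy
    rwa [(cotModel E).range_eq_univ, mdifferentiableWithinAt_univ] at this
  have hyt : y.1 ∈ (extChartAt 𝓘(ℝ, E) p.proj).target := by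
    rw [← h1]
    exact (extChartAt 𝓘(ℝ, E) p.proj).map_source (by rwa [extChartAt_source])
  have hsymmQ : MDifferentiableAt 𝓘(ℝ, E) 𝓘(ℝ, E)
      (extChartAt 𝓘(ℝ, E) p.proj).symm y.1 := by
    have := mdifferentiableWithinAt_extChartAt_symm (I := 𝓘(ℝ, E)) hyt
    rwa [(𝓘(ℝ, E)).range_eq_univ, mdifferentiableWithinAt_univ] at this
  have hproj : MDifferentiableAt (cotModel E) 𝓘(ℝ, E)
      (Bundle.TotalSpace.proj : Cotangent E Q → Q) ((extChartAt (cotModel E) p).symm y) :=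
    (contMDiffAt_proj (n := 1) _).mdifferentiableAt one_ne_zero
  -- Differentiating this identity by the chain rule on both sides moves the inverse chart of $T^*Q$
  -- past $T\pi_Q$.
  have hcomp : (Bundle.TotalSpace.proj : Cotangent E Q → Q) ∘ (extChartAt (cotModel E) p).symm
      =ᶠ[𝓝 y] (extChartAt 𝓘(ℝ, E) p.proj).symm ∘ Prod.fst := by
    filter_upwards [(isOpen_extChartAt_target (I := cotModel E) p).mem_nhds hy] with z hz
    obtain ⟨hs', h1', -⟩ := Cotangent.extChartAt_symm_spec p hz
    simp only [Function.comp_apply]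
    rw [← h1', (extChartAt 𝓘(ℝ, E) p.proj).left_inv (by rwa [extChartAt_source])]
  have hderiv := hcomp.mfderiv_eq (I := 𝓘(ℝ, E × (E →L[ℝ] ℝ))) (I' := 𝓘(ℝ, E))
  rw [mfderiv_comp y hproj hsymm,
    mfderiv_comp y hsymmQ differentiableAt_fst.mdifferentiableAt, mfderiv_eq_fderiv,
    fderiv_fst] at hderiv
  unfold OneForm.inChart liouvilleForm
  congr 1
  rw [← h2]
  refine ContinuousLinearMap.ext fun z => ?_
  exact congrArg ((extChartAt (cotModel E) p).symm y).2 (DFunLike.congr_fun hderiv z)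

/-- The coefficients of $\theta$ are linear in the chart at `p`, and that chart has identity
derivative at its centre, so components of tangent vectors there are coordinates. -/
theorem canonicalForm_apply (p : Cotangent E Q) (u v : TangentSpace (cotModel E) p) :
    canonicalForm E Q p ![u, v] =
      (show E × (E →L[ℝ] ℝ) from v).2 (show E × (E →L[ℝ] ℝ) from u).1 -
      (show E × (E →L[ℝ] ℝ) from u).2 (show E × (E →L[ℝ] ℝ) from v).1 := by
  have hT : IsManifold (cotModel E) ∞ (Cotangent E Q) := inferInstance
  have hT1 : IsManifold (cotModel E) 1 (Cotangent E Q) := IsManifold.of_le (n := ∞) (by simp)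
  let c : (E × (E →L[ℝ] ℝ)) →L[ℝ] (E × (E →L[ℝ] ℝ)) →L[ℝ] ℝ :=
    (ContinuousLinearMap.precomp ℝ (ContinuousLinearMap.fst ℝ E (E →L[ℝ] ℝ))).comp
      (ContinuousLinearMap.snd ℝ E (E →L[ℝ] ℝ))
  have h : extDeriv ((liouvilleForm E Q).inChart p) (extChartAt (cotModel E) p p) ![u, v] =
      c u v - c v u := by
    rw [(liouvilleForm_inChart_eventuallyEq p).extDeriv_eq]
    exact extDeriv_ofSubsingleton_linear_apply c _ u v
  have h' : canonicalForm E Q p ![u, v] =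
      -(extDeriv ((liouvilleForm E Q).inChart p) (extChartAt (cotModel E) p p) ![u, v]) := by
    unfold canonicalForm OneForm.d
    rw [mfderiv_extChartAt_self]
    rfl
  rw [h', h, neg_sub]
  rfl

/-- The expression of a 1-form in the chart at `q` is the second component of its expression as a
map into `T*Q`. -/
theorem OneForm.inChart_eventuallyEq (γ : OneForm 𝓘(ℝ, E) Q) (q : Q) :
    γ.inChart q =ᶠ[𝓝 (extChartAt 𝓘(ℝ, E) q q)] fun y =>
      ContinuousAlternatingMap.ofSubsingleton ℝ E ℝ (0 : Fin 1)
        (writtenInExtChartAt 𝓘(ℝ, E) (cotModel E) q (fun q => (⟨q, γ q⟩ : Cotangent E Q)) y).2 := by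
  filter_upwards [extChartAt_target_mem_nhds (I := 𝓘(ℝ, E)) q] with y hy
  have hs := (extChartAt 𝓘(ℝ, E) q).map_target hy
  rw [extChartAt_source] at hs
  unfold OneForm.inChart
  congr 1
  simp only [writtenInExtChartAt, Function.comp_apply]
  rw [Cotangent.extChartAt_apply ⟨q, γ q⟩ ⟨_, γ ((extChartAt 𝓘(ℝ, E) q).symm y)⟩ hs]
  simp only
  rw [(extChartAt 𝓘(ℝ, E) q).right_inv hy]
  rfl

/-- A 1-form, regarded as a map `Q → T*Q`, pulls the canonical symplectic form back to minus its
exterior derivative. -/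
theorem canonicalForm_mfderiv_oneForm {γ : OneForm 𝓘(ℝ, E) Q} {q : Q}
    (hγ : MDifferentiableAt 𝓘(ℝ, E) (cotModel E) (fun q => (⟨q, γ q⟩ : Cotangent E Q)) q)
    (u v : TangentSpace 𝓘(ℝ, E) q) :
    canonicalForm E Q ⟨q, γ q⟩
      ![mfderiv 𝓘(ℝ, E) (cotModel E) (fun q => (⟨q, γ q⟩ : Cotangent E Q)) q u,
        mfderiv 𝓘(ℝ, E) (cotModel E) (fun q => (⟨q, γ q⟩ : Cotangent E Q)) q v] =
      -(γ.d q ![u, v]) := by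
  have hQ : IsManifold 𝓘(ℝ, E) 1 Q := IsManifold.of_le (n := ∞) (by simp)
  set σ : Q → Cotangent E Q := fun q => ⟨q, γ q⟩ with hσ
  set w := writtenInExtChartAt 𝓘(ℝ, E) (cotModel E) q σ with hw
  have hdw : DifferentiableAt ℝ w (extChartAt 𝓘(ℝ, E) q q) := by
    have := hγ.differentiableWithinAt_writtenInExtChartAt
    rwa [(𝓘(ℝ, E)).range_eq_univ, differentiableWithinAt_univ] at this
  have hmf (u : TangentSpace 𝓘(ℝ, E) q) : mfderiv 𝓘(ℝ, E) (cotModel E) σ q u =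
      fderiv ℝ w (extChartAt 𝓘(ℝ, E) q q) u := by
    rw [hγ.mfderiv, (𝓘(ℝ, E)).range_eq_univ, fderivWithin_univ]
    rfl
  -- Since $\gamma$ is a section, its coordinate expression is $y\mapsto(y,g(y))$ with derivative
  -- $u\mapsto(u,Dg\,u)$.
  have hfst : (fun y => (w y).1) =ᶠ[𝓝 (extChartAt 𝓘(ℝ, E) q q)] id := by
    filter_upwards [extChartAt_target_mem_nhds (I := 𝓘(ℝ, E)) q] with y hy
    have hs := (extChartAt 𝓘(ℝ, E) q).map_target hy
    rw [extChartAt_source] at hs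
    simp only [hw, writtenInExtChartAt, Function.comp_apply, hσ]
    rw [Cotangent.extChartAt_apply ⟨q, γ q⟩ ⟨_, γ ((extChartAt 𝓘(ℝ, E) q).symm y)⟩ hs]
    exact (extChartAt 𝓘(ℝ, E) q).right_inv hy
  have h1 (u : E) : (fderiv ℝ w (extChartAt 𝓘(ℝ, E) q q) u).1 = u := by
    have := hfst.fderiv_eq (𝕜 := ℝ)
    rw [fderiv.fst hdw, fderiv_id] at this
    exact congrArg (fun A : E →L[ℝ] E => A u) this
  have h2 (u : E) : (fderiv ℝ w (extChartAt 𝓘(ℝ, E) q q) u).2 =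
      fderiv ℝ (fun y => (w y).2) (extChartAt 𝓘(ℝ, E) q q) u := by
    rw [fderiv.snd hdw]
    rfl
  have hd : γ.d q ![u, v] =
      extDeriv (γ.inChart q) (extChartAt 𝓘(ℝ, E) q q) ![u, v] := by
    unfold OneForm.d
    rw [mfderiv_extChartAt_self]
    rfl
  have hd' : γ.d q ![u, v] = fderiv ℝ (fun y => (w y).2) (extChartAt 𝓘(ℝ, E) q q) u v -
      fderiv ℝ (fun y => (w y).2) (extChartAt 𝓘(ℝ, E) q q) v u := by
    rw [hd, (OneForm.inChart_eventuallyEq γ q).extDeriv_eq]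
    exact extDeriv_ofSubsingleton_apply hdw.snd u v
  rw [hd', canonicalForm_apply, hmf, hmf, neg_sub]
  refine congrArg₂ _ ?_ ?_
  · exact congrArg₂ (fun (a : E →L[ℝ] ℝ) (b : E) => a b) (h2 v) (h1 u)
  · exact congrArg₂ (fun (a : E →L[ℝ] ℝ) (b : E) => a b) (h2 u) (h1 v)

end Coordinates

/-! ### Geometry of a constraint submanifold and of a section of it -/

theorem canonicalForm_eq_zero_of_fst_eq_zero {E : Type*} [NormedAddCommGroup E] [NormedSpace ℝ E]
    {Q : Type*} [TopologicalSpace Q] [ChartedSpace E Q] [IsManifold 𝓘(ℝ, E) ∞ Q]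
    {p : Cotangent E Q} {u v : TangentSpace (cotModel E) p}
    (hu : (show E × (E →L[ℝ] ℝ) from u).1 = 0) (hv : (show E × (E →L[ℝ] ℝ) from v).1 = 0) :
    canonicalForm E Q p ![u, v] = 0 := by
  rw [canonicalForm_apply, hu, hv, map_zero, map_zero, sub_zero]

theorem EmbeddedSubmanifold.contMDiff_val {E H M : Type*} [NormedAddCommGroup E] [NormedSpace ℝ E]
    [TopologicalSpace H] [TopologicalSpace M] [ChartedSpace H M] {I : ModelWithCorners ℝ E H}
    (S : EmbeddedSubmanifold I M) : ContMDiff (𝓡 S.dim) I ∞ (Subtype.val : S.carrier → M) :=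
  S.isSmoothEmbedding.contMDiff

/-- Let `β` be a biadditive form, `T` a section of `pr` with isotropic image, and suppose that the
kernel of `pr` is isotropic. If `β(x, ·) = α`, then `x - T(pr x)` is in the kernel of `β` if and only
if `α` vanishes on the image of `T`. -/
theorem forall_sub_apply_eq_zero_iff {V W : Type*} [AddCommGroup V] [Module ℝ V] [AddCommGroup W]
    [Module ℝ W] (β : V → V → ℝ) (hl : ∀ u u' v, β (u + u') v = β u v + β u' v)
    (hr : ∀ u v v', β u (v + v') = β u v + β u v') (pr : V →ₗ[ℝ] W) (T : W →ₗ[ℝ] V)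
    (hprT : ∀ w, pr (T w) = w) (hT : ∀ w w', β (T w) (T w') = 0)
    (hpr : ∀ u v, pr u = 0 → pr v = 0 → β u v = 0) {x : V} {α : V → ℝ} (hx : ∀ v, β x v = α v) :
    (∀ v, β (x - T (pr x)) v = 0) ↔ ∀ w, α (T w) = 0 := by
  have hvert (v) : pr (v - T (pr v)) = 0 := by rw [map_sub, hprT, sub_self]
  have htangent (w) : β (x - T (pr x)) (T w) = α (T w) := by
    have h := hl (x - T (pr x)) (T (pr x)) (T w)
    rw [sub_add_cancel, hx, hT, add_zero] at h
    exact h.symm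
  refine ⟨fun h w => (htangent w).symm.trans (h _), fun h v => ?_⟩
  -- Splits `v` into its vertical part and its part in the image of `T`; the first pairs to zero
  -- with the vertical vector `x - T (pr x)`.
  have h1 := hr (x - T (pr x)) (v - T (pr v)) (T (pr v))
  rwa [sub_add_cancel, hpr _ _ (hvert x) (hvert v), htangent, h, zero_add] at h1

section TwoForm

variable {E H M : Type*} [NormedAddCommGroup E] [NormedSpace ℝ E] [TopologicalSpace H]
  [TopologicalSpace M] [ChartedSpace H M]
  {E' H' M' : Type*} [NormedAddCommGroup E'] [NormedSpace ℝ E'] [TopologicalSpace H']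
  [TopologicalSpace M'] [ChartedSpace H' M']
  {I : ModelWithCorners ℝ E H} {I' : ModelWithCorners ℝ E' H'}

theorem TwoForm.pullback_apply (f : M → M') (β : TwoForm I' M') (x : M) (u v : TangentSpace I x) :
    (TwoForm.pullback f β : TwoForm I M) x ![u, v] =
      β (f x) ![mfderiv I I' f x u, mfderiv I I' f x v] := by
  refine congrArg (β (f x)) ?_
  ext i
  fin_cases i <;> rfl

theorem TwoForm.add_left (β : TwoForm I M) (x : M) (u u' v : TangentSpace I x) :
    β x ![u + u', v] = β x ![u, v] + β x ![u', v] := by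
  have h (w : TangentSpace I x) : Function.update ![u, v] 0 w = ![w, v] := by
    ext i
    fin_cases i <;> rfl
  have := (β x).map_update_add ![u, v] 0 u u'
  rwa [h, h, h] at this

theorem TwoForm.add_right (β : TwoForm I M) (x : M) (u v v' : TangentSpace I x) :
    β x ![u, v + v'] = β x ![u, v] + β x ![u, v'] := by
  have h (w : TangentSpace I x) : Function.update ![u, v] 1 w = ![u, w] := by
    ext i
    fin_cases i <;> rfl
  have := (β x).map_update_add ![u, v] 1 v v'
  rwa [h, h, h] at this

end TwoForm

/-! ### Isotropy of vertical vectors and of the section -/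

section Constraint

variable {E : Type*} [NormedAddCommGroup E] [NormedSpace ℝ E]
  {Q : Type*} [TopologicalSpace Q] [ChartedSpace E Q] [IsManifold 𝓘(ℝ, E) ∞ Q]
  {M₁ : EmbeddedSubmanifold (cotModel E) (Cotangent E Q)}
  {N : EmbeddedSubmanifold (𝓡 M₁.dim) M₁.carrier} {P : EmbeddedSubmanifold 𝓘(ℝ, E) Q}

/-- The inclusion of a constraint submanifold into `T*Q`. -/
def toCotangent (p : N.carrier) : Cotangent E Q := p.1.1

theorem contMDiff_toCotangent :
    ContMDiff (𝓡 N.dim) (cotModel E) ∞ (toCotangent : N.carrier → Cotangent E Q) :=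
  M₁.contMDiff_val.comp N.contMDiff_val

theorem mdifferentiableAt_toCotangent (p : N.carrier) :
    MDifferentiableAt (𝓡 N.dim) (cotModel E) (toCotangent : N.carrier → Cotangent E Q) p :=
  contMDiff_toCotangent.mdifferentiable (by simp) p

theorem mfderiv_toCotangent_apply (p : N.carrier) (u : TangentSpace (𝓡 N.dim) p) :
    mfderiv (𝓡 N.dim) (cotModel E) (toCotangent : N.carrier → Cotangent E Q) p u =
      mfderiv (𝓡 M₁.dim) (cotModel E) (Subtype.val : M₁.carrier → Cotangent E Q) p.1
        (mfderiv (𝓡 N.dim) (𝓡 M₁.dim) (Subtype.val : N.carrier → M₁.carrier) p u) :=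
  mfderiv_comp_apply p (M₁.contMDiff_val.mdifferentiable (by simp) _)
    (N.contMDiff_val.mdifferentiable (by simp) _) u

/-- Merges the two successive pullbacks into one, so that the coordinate formula for $\omega_Q$
applies. -/
theorem constraintForm_apply (p : N.carrier) (u v : TangentSpace (𝓡 N.dim) p) :
    constraintForm N p ![u, v] = canonicalForm E Q (toCotangent p)
      ![mfderiv (𝓡 N.dim) (cotModel E) toCotangent p u,
        mfderiv (𝓡 N.dim) (cotModel E) toCotangent p v] :=
  (TwoForm.pullback_apply _ _ _ _ _).trans <| (TwoForm.pullback_apply _ _ _ _ _).trans <|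
    congrArg₂ (fun a b => canonicalForm E Q (toCotangent p) ![a, b])
      (mfderiv_toCotangent_apply p u).symm (mfderiv_toCotangent_apply p v).symm

/-- Differentiates the commuting square formed by `projTo`, the inclusions and $\pi_Q$: vertical for
$\pi_f$ implies vertical for $\pi_Q$. -/
theorem mfderiv_toCotangent_fst_eq_zero (hP : P.carrier = range (basePoint (N := N)))
    {p : N.carrier} (hπ : MDifferentiableAt (𝓡 N.dim) (𝓡 P.dim) (projTo hP) p)
    {u : TangentSpace (𝓡 N.dim) p} (hu : mfderiv (𝓡 N.dim) (𝓡 P.dim) (projTo hP) p u = 0) :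
    (show E × (E →L[ℝ] ℝ) from mfderiv (𝓡 N.dim) (cotModel E) toCotangent p u).1 = 0 := by
  have h1 : mfderiv (𝓡 N.dim) 𝓘(ℝ, E) ((Bundle.TotalSpace.proj : Cotangent E Q → Q) ∘
      (toCotangent : N.carrier → Cotangent E Q)) p u =
      mfderiv (cotModel E) 𝓘(ℝ, E) (Bundle.TotalSpace.proj : Cotangent E Q → Q)
        (toCotangent p) (mfderiv (𝓡 N.dim) (cotModel E) toCotangent p u) :=
    mfderiv_comp_apply p ((contMDiffAt_proj (n := 1) _).mdifferentiableAt one_ne_zero)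
      (mdifferentiableAt_toCotangent p) u
  have h2 : mfderiv (𝓡 N.dim) 𝓘(ℝ, E) ((Subtype.val : P.carrier → Q) ∘ projTo hP) p u = 0 :=
    (mfderiv_comp_apply p (P.contMDiff_val.mdifferentiable (by simp) _) hπ u).trans
      ((congrArg _ hu).trans (map_zero _))
  exact (Cotangent.mfderiv_proj_apply _ _).symm.trans (h1.symm.trans h2)

/-- The vertical tangent vectors of a constraint submanifold are isotropic. -/
theorem constraintForm_vertical (hP : P.carrier = range (basePoint (N := N)))
    {p : N.carrier} (hπ : MDifferentiableAt (𝓡 N.dim) (𝓡 P.dim) (projTo hP) p)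
    {u v : TangentSpace (𝓡 N.dim) p} (hu : mfderiv (𝓡 N.dim) (𝓡 P.dim) (projTo hP) p u = 0)
    (hv : mfderiv (𝓡 N.dim) (𝓡 P.dim) (projTo hP) p v = 0) :
    constraintForm N p ![u, v] = 0 :=
  (constraintForm_apply p u v).trans (canonicalForm_eq_zero_of_fst_eq_zero
    (mfderiv_toCotangent_fst_eq_zero hP hπ hu) (mfderiv_toCotangent_fst_eq_zero hP hπ hv))

variable {γ : OneForm 𝓘(ℝ, E) Q}

/-- Smoothness into an immersed manifold can be tested after the inclusion once continuity is known,
and the subspace topologies provide continuity. -/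
theorem contMDiff_restrictTo (hγ : ContMDiff 𝓘(ℝ, E) (cotModel E) ∞
      (fun q => (⟨q, γ q⟩ : Cotangent E Q)))
    (hγN : ∀ q ∈ P.carrier, ∃ hq : (⟨q, γ q⟩ : Cotangent E Q) ∈ M₁.carrier,
      (⟨⟨q, γ q⟩, hq⟩ : M₁.carrier) ∈ N.carrier) :
    ContMDiff (𝓡 P.dim) (𝓡 N.dim) ∞ (restrictTo γ hγN) := by
  have h : ContMDiff (𝓡 P.dim) (cotModel E) ∞
      (fun q : P.carrier => (⟨q, γ q⟩ : Cotangent E Q)) := hγ.comp P.contMDiff_val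
  rw [ContMDiff.iff_comp_isImmersion N.isSmoothEmbedding.isImmersion,
    ContMDiff.iff_comp_isImmersion M₁.isSmoothEmbedding.isImmersion]
  exact ⟨(h.continuous.subtype_mk _).subtype_mk _, h.continuous.subtype_mk _, h⟩

/-- A section of a constraint submanifold given by a 1-form whose exterior derivative vanishes on
the base is isotropic. -/
theorem constraintForm_mfderiv_restrictTo (hγ : ContMDiff 𝓘(ℝ, E) (cotModel E) ∞
      (fun q => (⟨q, γ q⟩ : Cotangent E Q)))
    (hγN : ∀ q ∈ P.carrier, ∃ hq : (⟨q, γ q⟩ : Cotangent E Q) ∈ M₁.carrier,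
      (⟨⟨q, γ q⟩, hq⟩ : M₁.carrier) ∈ N.carrier) {q : P.carrier}
    (hdγ : (TwoForm.pullback Subtype.val γ.d : TwoForm (𝓡 P.dim) P.carrier) q = 0)
    (u v : TangentSpace (𝓡 P.dim) q) :
    constraintForm N (restrictTo γ hγN q)
      ![mfderiv (𝓡 P.dim) (𝓡 N.dim) (restrictTo γ hγN) q u,
        mfderiv (𝓡 P.dim) (𝓡 N.dim) (restrictTo γ hγN) q v] = 0 := by
  have hσ : MDifferentiableAt 𝓘(ℝ, E) (cotModel E)
      (fun q => (⟨q, γ q⟩ : Cotangent E Q)) (q : Q) := hγ.mdifferentiable (by simp) _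
  -- The inclusion of $N$ after $\gamma_f$ equals $\gamma$ after the inclusion of $Q_f$; both sides
  -- come from the chain rule.
  have h3 (w : TangentSpace (𝓡 P.dim) q) :
      mfderiv (𝓡 N.dim) (cotModel E) toCotangent (restrictTo γ hγN q)
        (mfderiv (𝓡 P.dim) (𝓡 N.dim) (restrictTo γ hγN) q w) =
      mfderiv 𝓘(ℝ, E) (cotModel E) (fun q => (⟨q, γ q⟩ : Cotangent E Q)) (q : Q)
        (mfderiv (𝓡 P.dim) 𝓘(ℝ, E) (Subtype.val : P.carrier → Q) q w) :=
    (mfderiv_comp_apply q (mdifferentiableAt_toCotangent _)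
      ((contMDiff_restrictTo hγ hγN).mdifferentiable (by simp) q) w).symm.trans
      (mfderiv_comp_apply q hσ (P.contMDiff_val.mdifferentiable (by simp) q) w)
  have h4 : γ.d (q : Q) ![mfderiv (𝓡 P.dim) 𝓘(ℝ, E) (Subtype.val : P.carrier → Q) q u,
      mfderiv (𝓡 P.dim) 𝓘(ℝ, E) (Subtype.val : P.carrier → Q) q v] = 0 :=
    (TwoForm.pullback_apply _ _ _ _ _).symm.trans
      (congrArg (fun β : TangentSpace (𝓡 P.dim) q [⋀^Fin 2]→L[ℝ] ℝ => β ![u, v]) hdγ)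
  exact (constraintForm_apply _ _ _).trans <|
    (congrArg₂ (fun a b => canonicalForm E Q ⟨q, γ q⟩ ![a, b]) (h3 u) (h3 v)).trans <|
    (canonicalForm_mfderiv_oneForm hσ _ _).trans ((congrArg Neg.neg h4).trans neg_zero)

theorem mfderiv_projTo_mfderiv_restrictTo (hP : P.carrier = range (basePoint (N := N)))
    (hγ : ContMDiff 𝓘(ℝ, E) (cotModel E) ∞ (fun q => (⟨q, γ q⟩ : Cotangent E Q)))
    (hγN : ∀ q ∈ P.carrier, ∃ hq : (⟨q, γ q⟩ : Cotangent E Q) ∈ M₁.carrier,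
      (⟨⟨q, γ q⟩, hq⟩ : M₁.carrier) ∈ N.carrier) {q : P.carrier}
    (hπ : MDifferentiableAt (𝓡 N.dim) (𝓡 P.dim) (projTo hP) (restrictTo γ hγN q))
    (u : TangentSpace (𝓡 P.dim) q) :
    mfderiv (𝓡 N.dim) (𝓡 P.dim) (projTo hP) (restrictTo γ hγN q)
      (mfderiv (𝓡 P.dim) (𝓡 N.dim) (restrictTo γ hγN) q u) = u := by
  have h1 : mfderiv (𝓡 P.dim) (𝓡 P.dim) (projTo hP ∘ restrictTo γ hγN) q =
      (mfderiv (𝓡 N.dim) (𝓡 P.dim) (projTo hP) (restrictTo γ hγN q)).comp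
        (mfderiv (𝓡 P.dim) (𝓡 N.dim) (restrictTo γ hγN) q) :=
    mfderiv_comp q hπ ((contMDiff_restrictTo hγ hγN).mdifferentiable (by simp) q)
  -- The composite is the identity by definition, because $\gamma$ preserves base points.
  have h2 : mfderiv (𝓡 P.dim) (𝓡 P.dim) (projTo hP ∘ restrictTo γ hγN) q =
      ContinuousLinearMap.id ℝ _ := mfderiv_id
  exact DFunLike.congr_fun (h1.symm.trans h2) u

/-- The Hamilton-Jacobi theorem on a constraint submanifold, at a point. -/
theorem sub_mem_ker_iff_mfderiv_eq_zero (hP : P.carrier = range (basePoint (N := N)))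
    (hγ : ContMDiff 𝓘(ℝ, E) (cotModel E) ∞ (fun q => (⟨q, γ q⟩ : Cotangent E Q)))
    (hγN : ∀ q ∈ P.carrier, ∃ hq : (⟨q, γ q⟩ : Cotangent E Q) ∈ M₁.carrier,
      (⟨⟨q, γ q⟩, hq⟩ : M₁.carrier) ∈ N.carrier) {q : P.carrier}
    (hdγ : (TwoForm.pullback Subtype.val γ.d : TwoForm (𝓡 P.dim) P.carrier) q = 0)
    (hπ : MDifferentiableAt (𝓡 N.dim) (𝓡 P.dim) (projTo hP) (restrictTo γ hγN q))
    {h : N.carrier → ℝ}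
    (hh : MDifferentiableAt (𝓡 N.dim) 𝓘(ℝ, ℝ) h (restrictTo γ hγN q))
    {X : TangentSpace (𝓡 N.dim) (restrictTo γ hγN q)} (hX : SolvesAt (constraintForm N) h _ X) :
    X - mfderiv (𝓡 P.dim) (𝓡 N.dim) (restrictTo γ hγN) q
        (mfderiv (𝓡 N.dim) (𝓡 P.dim) (projTo hP) (restrictTo γ hγN q) X) ∈
          (constraintForm N).ker (restrictTo γ hγN q) ↔
      mfderiv (𝓡 P.dim) 𝓘(ℝ, ℝ) (h ∘ restrictTo γ hγN) q = 0 := by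
  have hchain : mfderiv (𝓡 P.dim) 𝓘(ℝ, ℝ) (h ∘ restrictTo γ hγN) q =
      (mfderiv (𝓡 N.dim) 𝓘(ℝ, ℝ) h (restrictTo γ hγN q)).comp
        (mfderiv (𝓡 P.dim) (𝓡 N.dim) (restrictTo γ hγN) q) :=
    mfderiv_comp q hh ((contMDiff_restrictTo hγ hγN).mdifferentiable (by simp) q)
  refine (forall_sub_apply_eq_zero_iff (fun u v => constraintForm N (restrictTo γ hγN q) ![u, v])
    ((constraintForm N).add_left _) ((constraintForm N).add_right _)
    (mfderiv (𝓡 N.dim) (𝓡 P.dim) (projTo hP) (restrictTo γ hγN q)).toLinearMap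
    (mfderiv (𝓡 P.dim) (𝓡 N.dim) (restrictTo γ hγN) q).toLinearMap
    (mfderiv_projTo_mfderiv_restrictTo hP hγ hγN hπ)
    (constraintForm_mfderiv_restrictTo hγ hγN hdγ)
    (fun _ _ hu hv => constraintForm_vertical hP hπ hu hv) hX).trans ?_
  exact ⟨fun hu => ContinuousLinearMap.ext fun u => (DFunLike.congr_fun hchain u).trans (hu u),
    fun hzero u => (DFunLike.congr_fun hchain u).symm.trans (DFunLike.congr_fun hzero u)⟩

end Constraint

theorem mainTheorem4
    {E : Type*} [NormedAddCommGroup E] [NormedSpace ℝ E] [FiniteDimensional ℝ E]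
    {Q : Type*} [TopologicalSpace Q] [ChartedSpace E Q] [IsManifold 𝓘(ℝ, E) ∞ Q]
    -- an almost regular Lagrangian, and the projection of its energy to `M₁`
    (L : TangentBundle 𝓘(ℝ, E) Q → ℝ)
    (hL : ContMDiff (𝓘(ℝ, E)).tangent 𝓘(ℝ, ℝ) ∞ L)
    (M₁ : EmbeddedSubmanifold (cotModel E) (Cotangent E Q))
    (hM₁ : IsAlmostRegular L M₁)
    (h₁ : M₁.carrier → ℝ)
    (hh₁ : ∀ v, h₁ (legendreTo L hM₁.carrier_eq v) = energy L v)
    -- the Hinds algorithm stabilizes at `N_f = N k`, with a solution `X`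
    (N : ℕ → EmbeddedSubmanifold (𝓡 M₁.dim) M₁.carrier) (k : ℕ)
    (hN : HindsStabilizes h₁ N k)
    (X : ∀ p : (N k).carrier, TangentSpace (𝓡 (N k).dim) p)
    (hX : ContMDiff (𝓡 (N k).dim) (𝓡 (N k).dim).tangent ∞
      (fun p => (⟨p, X p⟩ : TangentBundle (𝓡 (N k).dim) (N k).carrier)))
    (hXsol : ∀ p, SolvesAt (constraintForm (N k)) (constraintFun h₁ (N k)) p (X p))
    -- `Q_f = π_Q(N_f)` is a submanifold of `Q`, and `π_f : N_f → Q_f` is a submersion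
    (Qf : EmbeddedSubmanifold 𝓘(ℝ, E) Q)
    (hQf : Qf.carrier = range (basePoint (N := N k)))
    (hπ : IsSubmersion (𝓡 (N k).dim) (𝓡 Qf.dim) ∞ (projTo hQf))
    -- a 1-form `γ` on `Q` with `γ(Q_f) ⊆ N_f` whose differential vanishes on `Q_f`
    (γ : OneForm 𝓘(ℝ, E) Q)
    (hγ : ContMDiff 𝓘(ℝ, E) (cotModel E) ∞ (fun q => (⟨q, γ q⟩ : Cotangent E Q)))
    (hγN : ∀ q ∈ Qf.carrier, ∃ hq : (⟨q, γ q⟩ : Cotangent E Q) ∈ M₁.carrier,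
      (⟨⟨q, γ q⟩, hq⟩ : M₁.carrier) ∈ (N k).carrier)
    (hdγ : ∀ q : Qf.carrier,
      (TwoForm.pullback Subtype.val γ.d : TwoForm (𝓡 Qf.dim) Qf.carrier) q = 0) :
    (∀ q : Qf.carrier,
        X (restrictTo γ hγN q) -
            mfderiv (𝓡 Qf.dim) (𝓡 (N k).dim) (restrictTo γ hγN) q
              (projectedField hQf γ hγN X q) ∈
          (constraintForm (N k)).ker (restrictTo γ hγN q)) ↔
      ∀ q : Qf.carrier,
        mfderiv (𝓡 Qf.dim) 𝓘(ℝ, ℝ) (fun x => h₁ (restrictTo γ hγN x)) q = 0 := by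
  -- Differentiability of $h_1$ is essential for the chain rule, since `mfderiv` is zero by default
  -- at points of non-differentiability.
  have hh : ContMDiff (𝓡 M₁.dim) 𝓘(ℝ, ℝ) ∞ h₁ := hM₁.contMDiff_of_comp_eq_energy hL hh₁
  exact forall_congr' fun q => sub_mem_ker_iff_mfderiv_eq_zero hQf hγ hγN (hdγ q)
    (hπ.contMDiff.mdifferentiable (by simp) _)
    ((hh.comp (N k).contMDiff_val).mdifferentiable (by simp) _) (hXsol _)
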